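/- A finitary matroid is a pair $M=(E,\mathcal{I})$, where $E$ is a (possibly infinite) set and $\mathcal{I}\subseteq\mathcal{P}(E)$, such that: (I) $\emptyset\in\mathcal{I}$; (II) $\mathcal{I}$ is closed under taking subsets; (III) if $I,J\in\mathcal{I}$ with $|I|<|J|$, then there is an $e\in J\setminus I$ such that $I\cup\{e\}\in\mathcal{I}$; (IV) if all finite subsets of an infinite set $X\subseteq E$ are in $\mathcal{I}$, then $X\in\mathcal{I}$. Equivalently, it is a (possibly infinite) matroid in which a set is independent as soon as all of its finite subsets are. A base of $M$ is a $\subseteq$-maximal element of $\mathcal{I}$. For a set $X$, let $[X]^{<\aleph_0}$ denote the set of finite subsets of $X$. Theorem. Let $M=(E,\mathcal{I})$ be a finitary matroid and let $B_0$ and $B_1$ be bases of $M$. Then there is a bijection $F:[B_0]^{<\aleph_0}\rightarrow[B_1]^{<\aleph_0}$ such that $(B_0\setminus I)\cup F(I)$ is a base of $M$ for every $I\in[B_0]^{<\aleph_0}$. -/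

import Mathlib

/-!
If `P` and `Q` are bases and `e ∈ P`, `f ∈ Q` are exchanged symmetrically, then `P - e` and `Q - f`
are bases of both `M / e` and `M / f`. Keeping `e` amounts to continuing in `M / e`, and exchanging
`e` for `f` to continuing in `M / f`. Iterating this along an enumeration of countable bases gives a
binary tree; a branch with finitely many exchanges is determined by the finite set `I ⊆ P` it
exchanges as well as by the finite set `J ⊆ Q` it receives, so `I ↦ J` is the required bijection.

For uncountable bases one applies Zorn's lemma to exchange bijections between subsets `X ⊆ B₀` and
`Y ⊆ B₁` with the same closure. Any `e ∈ B₀ \ X` lies, `M` being finitary, in a countable part of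
`B₀ \ X` with the same closure in `M / X` as some countable part of `B₁ \ Y`; combining the
bijection for `M / X` on these parts with the given one enlarges the latter.
-/

open Set Matroid
open scoped SetFamily

universe u

variable {α : Type u}

/-- The family of finite subsets of `X`, written `[X]^{<ℵ₀}` in the paper. -/
def finiteSubsets (X : Set α) : Set (Set α) :=
  {I | I ⊆ X ∧ I.Finite}

theorem finiteSubsets_mono {X Y : Set α} (h : X ⊆ Y) : finiteSubsets X ⊆ finiteSubsets Y :=
  fun _ hI ↦ ⟨hI.1.trans h, hI.2⟩

theorem finiteSubsets_iUnion_of_directed {ι : Type*} [Nonempty ι] {X : ι → Set α}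
    (hX : Directed (· ⊆ ·) X) : finiteSubsets (⋃ i, X i) = ⋃ i, finiteSubsets (X i) := by
  refine Subset.antisymm (fun I ⟨hI, hfin⟩ ↦ ?_)
    (iUnion_subset fun i ↦ finiteSubsets_mono (subset_iUnion X i))
  lift I to Finset α using hfin
  obtain ⟨i, hi⟩ := hX.exists_mem_subset_of_finset_subset_biUnion hI
  exact mem_iUnion.2 ⟨i, hi, I.finite_toSet⟩

variable {M : Matroid α} {B P Q X Y K L : Set α} {e f x : α}

theorem indep_contract_of_closure_eq (h : M.closure X = M.closure Y) (hK : (M ／ X).Indep K) :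
    (M ／ Y).Indep K := by
  have hdisj : K ⊆ M.E \ M.closure X := fun e he ↦
    contract_isNonloop_iff.1 (hK.isNonloop_of_mem he)
  rw [indep_iff_forall_notMem_closure_sdiff'] at hK ⊢
  refine ⟨fun e he ↦ ⟨(hdisj he).1, fun heY ↦ (hdisj he).2 ?_⟩, fun e he hcl ↦ hK.2 e he ?_⟩
  · rw [h]
    exact M.mem_closure_of_mem' heY (hdisj he).1
  · rw [contract_closure_eq, closure_union_congr_right h]
    rw [contract_closure_eq] at hcl
    exact ⟨hcl.1, (hK.1 he).2⟩

theorem isBase_contract_sdiff_of_closure_eq (hB : M.IsBase B) (hY : Y ⊆ B)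
    (h : M.closure X = M.closure Y) : (M ／ X).IsBase (B \ Y) := by
  refine (indep_contract_of_closure_eq h.symm
    (hB.indep.diff_indep_contract_of_subset hY)).isBase_of_ground_subset_closure ?_
  rw [contract_closure_eq, closure_union_congr_right h, sdiff_union_of_subset hY, hB.closure_eq,
    contract_ground]

theorem closure_union_eq_of_contract_closure_eq (h : (M ／ X).closure K = (M ／ X).closure L) :
    M.closure (X ∪ K) = M.closure (X ∪ L) := by
  have hdecomp (Z : Set α) : M.closure (X ∪ Z) = (M ／ X).closure Z ∪ X ∩ M.E := by
    have hX : X ∩ M.E ⊆ M.closure (X ∪ Z) := fun e he ↦ M.mem_closure_of_mem' (.inl he.1) he.2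
    rw [contract_closure_eq, union_comm Z]
    refine Subset.antisymm (fun e he ↦ ?_) (union_subset sdiff_subset hX)
    exact (em (e ∈ X)).symm.imp (⟨he, ·⟩) (⟨·, mem_ground_of_mem_closure he⟩)
  rw [hdecomp, hdecomp, h]

theorem isBasis_closure_union_of_contract (hK : M.IsBasis K (M.closure X))
    (hL : (M ／ X).IsBasis L ((M ／ X).closure P)) :
    M.IsBasis (K ∪ L) (M.closure (X ∪ P)) := by
  have hKL : M.Indep (K ∪ L) := union_comm L K ▸ (hK.indep.contract_indep_iff.1
    (indep_contract_of_closure_eq hK.closure_eq_right.symm hL.indep)).2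
  rw [← closure_union_eq_of_contract_closure_eq hL.closure_eq_right,
    ← closure_union_congr_left hK.closure_eq_right]
  exact hKL.isBasis_closure

theorem isBase_contractElem_of_isBase_insert (h : M.IsBase (insert e B)) (he : e ∉ B) :
    (M ／ {e}).IsBase B := by
  rw [(h.indep.subset (singleton_subset_iff.2 (mem_insert e B))).contract_isBase_iff,
    union_singleton]
  exact ⟨h, disjoint_singleton_right.2 he⟩

theorem isBase_contractElem_sdiff (hB : M.IsBase B) (he : e ∈ B) :
    (M ／ {e}).IsBase (B \ {e}) :=
  isBase_contractElem_of_isBase_insert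
    (by rwa [insert_sdiff_singleton, insert_eq_of_mem he]) (by simp)

/-- Bases `P` and `Q` admit a symmetric exchange of `e ∈ P` for `f ∈ Q`, phrased by contraction:
both `P - e` and `Q - f` are bases of `M / f` and of `M / e` respectively. The case `e = f` is
allowed. -/
structure IsExchangePair (M : Matroid α) (P Q : Set α) (e f : α) : Prop where
  mem_left : e ∈ P
  mem_right : f ∈ Q
  isBase_left : (M ／ {f}).IsBase (P \ {e})
  isBase_right : (M ／ {e}).IsBase (Q \ {f})

theorem IsExchangePair.symm (h : IsExchangePair M P Q e f) : IsExchangePair M Q P f e :=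
  ⟨h.mem_right, h.mem_left, h.isBase_right, h.isBase_left⟩

theorem exists_isExchangePair_of_mem_left (hP : M.IsBase P) (hQ : M.IsBase Q) (he : e ∈ P) :
    ∃ f, IsExchangePair M P Q e f ∧ (e ∈ Q → f = e) := by
  by_cases heQ : e ∈ Q
  · exact ⟨e, ⟨he, heQ, isBase_contractElem_sdiff hP he,
      isBase_contractElem_sdiff hQ heQ⟩, fun _ ↦ rfl⟩
  have heE := hP.subset_ground he
  have hC := hQ.fundCircuit_isCircuit heE heQ
  obtain ⟨f, ⟨hfC, hfe⟩, hf⟩ : ∃ f ∈ M.fundCircuit e Q \ {e}, f ∉ M.closure (P \ {e}) :=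
    not_subset.1 fun h ↦ hP.indep.notMem_closure_sdiff_of_mem he <|
      M.closure_subset_closure_of_subset_closure h <|
        hC.mem_closure_sdiff_singleton_of_mem (M.mem_fundCircuit e Q)
  have hfQ : f ∈ Q := ((M.fundCircuit_subset_insert e Q) hfC).resolve_left hfe
  have hfE := hQ.subset_ground hfQ
  have hQe : M.IsBase (insert e (Q \ {f})) := by
    refine hQ.exchange_isBase_of_indep heQ ?_
    rw [insert_sdiff_singleton_comm (Ne.symm hfe)]
    exact (hQ.indep.mem_fundCircuit_iff (by rwa [hQ.closure_eq]) heQ).1 hfC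
  exact ⟨f, ⟨he, hfQ,
    isBase_contractElem_of_isBase_insert (hP.exchange_base_of_notMem_closure he hf hfE)
      fun h ↦ hf (M.mem_closure_of_mem' h hfE),
    isBase_contractElem_of_isBase_insert hQe fun h ↦ heQ h.1⟩, fun h ↦ absurd h heQ⟩

theorem exists_isExchangePair (hP : M.IsBase P) (hQ : M.IsBase Q) (hx : x ∈ P ∪ Q) :
    ∃ e f, IsExchangePair M P Q e f ∧ x ∉ P \ {e} ∧ x ∉ Q \ {f} := by
  rcases hx with hx | hx
  · obtain ⟨f, h, hf⟩ := exists_isExchangePair_of_mem_left hP hQ hx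
    exact ⟨x, f, h, fun hx ↦ hx.2 rfl, fun hx ↦ hx.2 (hf hx.1).symm⟩
  · obtain ⟨e, h, he⟩ := exists_isExchangePair_of_mem_left hQ hP hx
    exact ⟨e, x, h.symm, fun hx ↦ hx.2 (he hx.1).symm, fun hx ↦ hx.2 rfl⟩

variable {R : Set (Set α × Set α)}

/-- `R` pairs finite subsets `I ⊆ X` injectively with finite subsets `J ⊆ Y` such that
`(X \ I) ∪ J` is a basis of the closure of `X`; a relation is used instead of a partial function so
that the roles of `X` and `Y` are symmetric. -/
structure IsPartialExchangeRel (M : Matroid α) (X Y : Set α) (R : Set (Set α × Set α)) : Prop where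
  mapsTo_fst : MapsTo Prod.fst R (finiteSubsets X)
  mapsTo_snd : MapsTo Prod.snd R (finiteSubsets Y)
  injOn_fst : InjOn Prod.fst R
  injOn_snd : InjOn Prod.snd R
  isBasis : ∀ p ∈ R, M.IsBasis ((X \ p.1) ∪ p.2) (M.closure X)

/-- `R` is the graph of a bijection `F` between the finite subsets of `X` and those of `Y` such that
every `(X \ I) ∪ F I` is a basis of the closure of `X`. -/
structure IsExchangeRel (M : Matroid α) (X Y : Set α) (R : Set (Set α × Set α)) : Prop
    extends IsPartialExchangeRel M X Y R where
  surjOn_fst : SurjOn Prod.fst R (finiteSubsets X)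
  surjOn_snd : SurjOn Prod.snd R (finiteSubsets Y)

theorem IsPartialExchangeRel.isBase {p : Set α × Set α} (h : IsPartialExchangeRel M X Y R)
    (hX : M.IsBase X) (hp : p ∈ R) : M.IsBase ((X \ p.1) ∪ p.2) := by
  have hbasis := h.isBasis p hp
  rwa [hX.closure_eq, isBasis_ground_iff] at hbasis

theorem IsExchangeRel.bijOn_fst (h : IsExchangeRel M X Y R) :
    BijOn Prod.fst R (finiteSubsets X) :=
  ⟨h.mapsTo_fst, h.injOn_fst, h.surjOn_fst⟩

theorem IsExchangeRel.bijOn_snd (h : IsExchangeRel M X Y R) :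
    BijOn Prod.snd R (finiteSubsets Y) :=
  ⟨h.mapsTo_snd, h.injOn_snd, h.surjOn_snd⟩

section DirectedUnion

variable {ι : Type*} {X Y : ι → Set α} {R : ι → Set (Set α × Set α)}

theorem IsPartialExchangeRel.iUnion_of_directed (h : ∀ i, IsPartialExchangeRel M (X i) (Y i) (R i))
    (hR : Directed (· ⊆ ·) R) (hX : M.Indep (⋃ i, X i)) :
    IsPartialExchangeRel M (⋃ i, X i) (⋃ i, Y i) (⋃ i, R i) where
  mapsTo_fst := mapsTo_iUnion.2 fun i ↦
    (h i).mapsTo_fst.mono_right (finiteSubsets_mono (subset_iUnion X i))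
  mapsTo_snd := mapsTo_iUnion.2 fun i ↦
    (h i).mapsTo_snd.mono_right (finiteSubsets_mono (subset_iUnion Y i))
  injOn_fst := inj_on_iUnion_of_directed hR fun i ↦ (h i).injOn_fst
  injOn_snd := inj_on_iUnion_of_directed hR fun i ↦ (h i).injOn_snd
  isBasis p hp := by
    obtain ⟨i, hp⟩ := mem_iUnion.1 hp
    have hXi : X i ⊆ ⋃ j, X j := subset_iUnion X i
    have hbasis := isBasis_closure_union_of_contract ((h i).isBasis p hp)
      (hX.diff_indep_contract_of_subset hXi).isBasis_closure
    rw [union_sdiff_cancel hXi] at hbasis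
    rwa [union_right_comm, union_comm (X i \ p.1),
      sdiff_union_sdiff_cancel hXi ((h i).mapsTo_fst hp).1] at hbasis

theorem IsExchangeRel.iUnion_of_directed [Nonempty ι] (h : ∀ i, IsExchangeRel M (X i) (Y i) (R i))
    (hX : Directed (· ⊆ ·) X) (hY : Directed (· ⊆ ·) Y) (hR : Directed (· ⊆ ·) R)
    (hindep : M.Indep (⋃ i, X i)) :
    IsExchangeRel M (⋃ i, X i) (⋃ i, Y i) (⋃ i, R i) where
  toIsPartialExchangeRel :=
    .iUnion_of_directed (fun i ↦ (h i).toIsPartialExchangeRel) hR hindep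
  surjOn_fst := by
    rw [finiteSubsets_iUnion_of_directed hX]
    exact surjOn_iUnion_iUnion fun i ↦ (h i).surjOn_fst
  surjOn_snd := by
    rw [finiteSubsets_iUnion_of_directed hY]
    exact surjOn_iUnion_iUnion fun i ↦ (h i).surjOn_snd

end DirectedUnion

section Branch

variable {β : Type*} {g : β → Set α} {φ : β → β} {R₀ R₁ : Set β}

theorem mapsTo_union_image_insert (hφ : ∀ r, g (φ r) = insert e (g r)) (he : e ∈ P)
    (h₀ : MapsTo g R₀ (finiteSubsets (P \ {e}))) (h₁ : MapsTo g R₁ (finiteSubsets (P \ {e}))) :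
    MapsTo g (R₀ ∪ φ '' R₁) (finiteSubsets P) := by
  refine (h₀.mono_right (finiteSubsets_mono sdiff_subset)).union
    (mapsTo_image_iff.2 fun r hr ↦ ?_)
  rw [Function.comp_apply, hφ]
  exact ⟨insert_subset he ((h₁ hr).1.trans sdiff_subset), (h₁ hr).2.insert e⟩

theorem injOn_union_image_insert (hφ : ∀ r, g (φ r) = insert e (g r))
    (h₀ : MapsTo g R₀ (finiteSubsets (P \ {e}))) (h₁ : MapsTo g R₁ (finiteSubsets (P \ {e})))
    (hg₀ : InjOn g R₀) (hg₁ : InjOn g R₁) : InjOn g (R₀ ∪ φ '' R₁) := by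
  have hnot₀ {r : β} (hr : r ∈ R₀) : e ∉ g r := fun he ↦ ((h₀ hr).1 he).2 rfl
  have hnot₁ {r : β} (hr : r ∈ R₁) : e ∉ g r := fun he ↦ ((h₁ hr).1 he).2 rfl
  have hne {r s : β} (hr : r ∈ R₀) : g r ≠ g (φ s) := fun h ↦
    hnot₀ hr (by rw [h, hφ]; exact mem_insert e _)
  rintro r (hr | ⟨r, hr, rfl⟩) s (hs | ⟨s, hs, rfl⟩) h
  · exact hg₀ hr hs h
  · exact absurd h (hne hr)
  · exact absurd h.symm (hne hs)
  · rw [hφ, hφ] at h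
    rw [hg₁ hr hs]
    rw [← insert_sdiff_self_of_notMem (hnot₁ hr), h, insert_sdiff_self_of_notMem (hnot₁ hs)]

theorem surjOn_union_image_insert (hφ : ∀ r, g (φ r) = insert e (g r))
    (h₀ : SurjOn g R₀ (finiteSubsets (P \ {e}))) (h₁ : SurjOn g R₁ (finiteSubsets (P \ {e}))) :
    SurjOn g (R₀ ∪ φ '' R₁) (finiteSubsets P) := by
  intro I hI
  have hIe : I \ {e} ∈ finiteSubsets (P \ {e}) := ⟨sdiff_subset_sdiff_left hI.1, hI.2.sdiff⟩
  by_cases he : e ∈ I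
  · obtain ⟨r, hr, hrI⟩ := h₁ hIe
    exact ⟨φ r, .inr (mem_image_of_mem φ hr), by rw [hφ, hrI, insert_sdiff_self_of_mem he]⟩
  · obtain ⟨r, hr, hrI⟩ := h₀ hIe
    exact ⟨r, .inl hr, by rw [hrI, sdiff_singleton_eq_self he]⟩

end Branch

section ExchangeTree

variable {R₀ R₁ : Set (Set α × Set α)}

theorem IsExchangePair.isPartialExchangeRel_branch (h : IsExchangePair M P Q e f)
    (hP : M.IsBase P) (hQ : M.IsBase Q)
    (h₀ : IsPartialExchangeRel (M ／ {e}) (P \ {e}) (Q \ {f}) R₀)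
    (h₁ : IsPartialExchangeRel (M ／ {f}) (P \ {e}) (Q \ {f}) R₁) :
    IsPartialExchangeRel M P Q (R₀ ∪ Prod.map (insert e) (insert f) '' R₁) where
  mapsTo_fst := mapsTo_union_image_insert (fun _ ↦ rfl) h.mem_left h₀.mapsTo_fst h₁.mapsTo_fst
  mapsTo_snd := mapsTo_union_image_insert (fun _ ↦ rfl) h.mem_right h₀.mapsTo_snd h₁.mapsTo_snd
  injOn_fst := injOn_union_image_insert (fun _ ↦ rfl) h₀.mapsTo_fst h₁.mapsTo_fst
    h₀.injOn_fst h₁.injOn_fst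
  injOn_snd := injOn_union_image_insert (fun _ ↦ rfl) h₀.mapsTo_snd h₁.mapsTo_snd
    h₀.injOn_snd h₁.injOn_snd
  isBasis := by
    rw [hP.closure_eq]
    rintro p (hp | ⟨p, hp, rfl⟩) <;> rw [isBasis_ground_iff]
    · have hbase := h₀.isBase (isBase_contractElem_sdiff hP h.mem_left) hp
      have he : e ∉ p.1 := fun he ↦ ((h₀.mapsTo_fst hp).1 he).2 rfl
      rw [(hP.indep.subset (singleton_subset_iff.2 h.mem_left)).contract_isBase_iff] at hbase
      convert hbase.1 using 1
      rw [sdiff_sdiff_comm, union_right_comm, sdiff_union_of_subset]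
      exact singleton_subset_iff.2 ⟨h.mem_left, he⟩
    · have hbase := h₁.isBase h.isBase_left hp
      rw [(hQ.indep.subset (singleton_subset_iff.2 h.mem_right)).contract_isBase_iff] at hbase
      rw [Prod.map_fst, Prod.map_snd, union_insert, ← singleton_union (a := e), ← sdiff_sdiff,
        ← union_singleton]
      exact hbase.1

open Classical in
/-- The branches, along the list `l`, of the binary tree that decides at `x ∈ l` between two
contractions: an exchange pair `(e, f)` that removes `x` from `P` and `Q` is chosen, and then
`e` is kept and contracted, or `e` is exchanged for `f` and `f` is contracted. A branch is recorded
as the pair of the set of all exchanged `e` and the set of all exchanged `f`. -/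
noncomputable def exchangeTree :
    List α → Matroid α → Set α → Set α → Set (Set α × Set α)
  | [], _, _, _ => {(∅, ∅)}
  | x :: l, M, P, Q =>
    if h : ∃ p : α × α, IsExchangePair M P Q p.1 p.2 ∧ x ∉ P \ {p.1} ∧ x ∉ Q \ {p.2} then
      exchangeTree l (M ／ {h.choose.1}) (P \ {h.choose.1}) (Q \ {h.choose.2}) ∪
        Prod.map (insert h.choose.1) (insert h.choose.2) ''
          exchangeTree l (M ／ {h.choose.2}) (P \ {h.choose.1}) (Q \ {h.choose.2})
    else exchangeTree l M P Q

theorem exchangeTree_cons_cases (hP : M.IsBase P) (hQ : M.IsBase Q) (x : α) (l : List α) :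
    (x ∉ P ∪ Q ∧ exchangeTree (x :: l) M P Q = exchangeTree l M P Q) ∨
    ∃ e f, IsExchangePair M P Q e f ∧ x ∉ P \ {e} ∧ x ∉ Q \ {f} ∧
      exchangeTree (x :: l) M P Q = exchangeTree l (M ／ {e}) (P \ {e}) (Q \ {f}) ∪
        Prod.map (insert e) (insert f) '' exchangeTree l (M ／ {f}) (P \ {e}) (Q \ {f}) := by
  by_cases h : ∃ p : α × α, IsExchangePair M P Q p.1 p.2 ∧ x ∉ P \ {p.1} ∧ x ∉ Q \ {p.2}
  · exact .inr ⟨_, _, h.choose_spec.1, h.choose_spec.2.1, h.choose_spec.2.2, dif_pos h⟩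
  · refine .inl ⟨fun hx ↦ h ?_, dif_neg h⟩
    obtain ⟨e, f, hef⟩ := exists_isExchangePair hP hQ hx
    exact ⟨(e, f), hef⟩

theorem empty_mem_exchangeTree (l : List α) (M : Matroid α) (P Q : Set α) :
    (∅, ∅) ∈ exchangeTree l M P Q := by
  induction l generalizing M P Q with
  | nil => exact mem_singleton _
  | cons x l ih =>
    rw [exchangeTree]
    split_ifs with h
    exacts [.inl (ih _ _ _), ih _ _ _]

theorem exchangeTree_subset_append (l l' : List α) (M : Matroid α) (P Q : Set α) :
    exchangeTree l M P Q ⊆ exchangeTree (l ++ l') M P Q := by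
  induction l generalizing M P Q with
  | nil => exact singleton_subset_iff.2 (empty_mem_exchangeTree l' M P Q)
  | cons x l ih =>
    rw [List.cons_append, exchangeTree, exchangeTree]
    split_ifs with h
    exacts [union_subset_union (ih _ _ _) (image_mono (ih _ _ _)), ih _ _ _]

theorem isPartialExchangeRel_exchangeTree (l : List α) (hP : M.IsBase P) (hQ : M.IsBase Q) :
    IsPartialExchangeRel M P Q (exchangeTree l M P Q) := by
  induction l generalizing M P Q with
  | nil =>
    have hempty (S : Set α) : ∅ ∈ finiteSubsets S := ⟨empty_subset S, finite_empty⟩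
    exact {
      mapsTo_fst := by rintro _ rfl; exact hempty P
      mapsTo_snd := by rintro _ rfl; exact hempty Q
      injOn_fst := injOn_singleton _ _
      injOn_snd := injOn_singleton _ _
      isBasis := by rintro _ rfl; simpa using hP.indep.isBasis_closure }
  | cons x l ih =>
    obtain ⟨-, h⟩ | ⟨e, f, hef, -, -, h⟩ := exchangeTree_cons_cases hP hQ x l
    · rw [h]
      exact ih hP hQ
    · rw [h]
      exact hef.isPartialExchangeRel_branch hP hQ
        (ih (isBase_contractElem_sdiff hP hef.mem_left) hef.isBase_right)
        (ih hef.isBase_left (isBase_contractElem_sdiff hQ hef.mem_right))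

theorem surjOn_exchangeTree (l : List α) (hP : M.IsBase P) (hQ : M.IsBase Q) :
    SurjOn Prod.fst (exchangeTree l M P Q) (finiteSubsets (P ∩ {x | x ∈ l})) ∧
      SurjOn Prod.snd (exchangeTree l M P Q) (finiteSubsets (Q ∩ {x | x ∈ l})) := by
  induction l generalizing M P Q with
  | nil => simp [finiteSubsets, exchangeTree, SurjOn]
  | cons x l ih =>
    have hdrop {S : Set α} (hS : x ∉ S) :
        finiteSubsets (S ∩ {y | y ∈ x :: l}) ⊆ finiteSubsets (S ∩ {y | y ∈ l}) := by
      refine finiteSubsets_mono fun y ⟨hyS, hyl⟩ ↦ ⟨hyS, (List.mem_cons.1 hyl).resolve_left ?_⟩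
      rintro rfl
      exact hS hyS
    obtain ⟨hx, h⟩ | ⟨e, f, hef, hxP, hxQ, h⟩ := exchangeTree_cons_cases hP hQ x l
    · rw [h]
      rw [mem_union, not_or] at hx
      exact (ih hP hQ).imp (·.mono subset_rfl (hdrop hx.1)) (·.mono subset_rfl (hdrop hx.2))
    · rw [h]
      obtain ⟨hfst₀, hsnd₀⟩ := ih (isBase_contractElem_sdiff hP hef.mem_left) hef.isBase_right
      obtain ⟨hfst₁, hsnd₁⟩ := ih hef.isBase_left (isBase_contractElem_sdiff hQ hef.mem_right)
      constructor <;> refine surjOn_union_image_insert (fun _ ↦ rfl) ?_ ?_ <;>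
        rw [← sdiff_inter_right_comm]
      exacts [hfst₀.mono subset_rfl (hdrop hxP), hfst₁.mono subset_rfl (hdrop hxP),
        hsnd₀.mono subset_rfl (hdrop hxQ), hsnd₁.mono subset_rfl (hdrop hxQ)]

end ExchangeTree

theorem exists_isExchangeRel_of_countable (hP : M.IsBase P) (hQ : M.IsBase Q) (hPc : P.Countable)
    (hQc : Q.Countable) : ∃ R, IsExchangeRel M P Q R ∧ (∅, ∅) ∈ R := by
  rcases isEmpty_or_nonempty α with hα | hα
  · have hsurj := surjOn_exchangeTree [] hP hQ
    rw [Subsingleton.elim (P ∩ _) P, Subsingleton.elim (Q ∩ _) Q] at hsurj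
    exact ⟨_, ⟨isPartialExchangeRel_exchangeTree [] hP hQ, hsurj.1, hsurj.2⟩,
      empty_mem_exchangeTree [] M P Q⟩
  obtain ⟨u, hu⟩ := countable_iff_exists_subset_range.1 (hPc.union hQc)
  let l (n : ℕ) : List α := (List.range n).map u
  have hmono : Monotone fun n ↦ exchangeTree (l n) M P Q := monotone_nat_of_le_succ fun n ↦ by
    simpa only [l, List.range_succ, List.map_append] using exchangeTree_subset_append _ _ M P Q
  have hexhaust {S : Set α} (hS : S ⊆ range u) :
      ⋃ n, finiteSubsets (S ∩ {x | x ∈ l n}) = finiteSubsets S := by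
    have hmono : Monotone fun n ↦ S ∩ {x | x ∈ l n} := fun m n hmn ↦
      inter_subset_inter_right S (List.map_subset u (List.range_subset.2 hmn))
    rw [← finiteSubsets_iUnion_of_directed hmono.directed_le, ← inter_iUnion, inter_eq_left.2]
    refine hS.trans (range_subset_iff.2 fun n ↦ mem_iUnion.2 ⟨n + 1, ?_⟩)
    exact List.mem_map_of_mem (List.mem_range.2 n.lt_succ_self)
  have hrel := IsPartialExchangeRel.iUnion_of_directed
    (fun n ↦ isPartialExchangeRel_exchangeTree (l n) hP hQ) hmono.directed_le
    (by rw [iUnion_const]; exact hP.indep)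
  rw [iUnion_const, iUnion_const] at hrel
  refine ⟨_, ⟨hrel, ?_, ?_⟩, mem_iUnion.2 ⟨0, empty_mem_exchangeTree (l 0) M P Q⟩⟩
  · rw [← hexhaust (subset_union_left.trans hu)]
    exact surjOn_iUnion_iUnion fun n ↦ (surjOn_exchangeTree (l n) hP hQ).1
  · rw [← hexhaust (subset_union_right.trans hu)]
    exact surjOn_iUnion_iUnion fun n ↦ (surjOn_exchangeTree (l n) hP hQ).2

theorem exists_isExchangeRel_of_countable_of_closure_eq (hP : M.Indep P) (hQ : M.Indep Q)
    (h : M.closure P = M.closure Q) (hPc : P.Countable) (hQc : Q.Countable) :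
    ∃ R, IsExchangeRel M P Q R ∧ (∅, ∅) ∈ R := by
  have hQP : M.IsBasis Q (M.closure P) := h ▸ hQ.isBasis_closure
  obtain ⟨R, hR, hempty⟩ := exists_isExchangeRel_of_countable hP.isBasis_closure.restrict_isBase
    hQP.restrict_isBase hPc hQc
  refine ⟨R, { hR with isBasis := fun p hp ↦ ?_ }, hempty⟩
  exact (isBase_restrict_iff (M.closure_subset_ground P)).1
    (hR.isBase hP.isBasis_closure.restrict_isBase hp)

section Sups

variable {β : Type*} [SemilatticeSup β] {g : β → Set α} {S T : Set β}

theorem bijOn_sups_finiteSubsets (hg : ∀ a b, g (a ⊔ b) = g a ∪ g b)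
    (hS : BijOn g S (finiteSubsets X)) (hT : BijOn g T (finiteSubsets P)) (hXP : Disjoint X P) :
    BijOn g (S ⊻ T) (finiteSubsets (X ∪ P)) := by
  have hinter {s t : β} (hs : s ∈ S) (ht : t ∈ T) : g (s ⊔ t) ∩ X = g s ∧ g (s ⊔ t) ∩ P = g t := by
    have hsX := (hS.mapsTo hs).1
    have htP := (hT.mapsTo ht).1
    rw [hg, union_inter_distrib_right, union_inter_distrib_right, inter_eq_left.2 hsX,
      inter_eq_left.2 htP, (hXP.symm.mono_left htP).inter_eq, (hXP.mono_left hsX).inter_eq,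
      union_empty, empty_union]
    exact ⟨rfl, rfl⟩
  refine ⟨?_, ?_, ?_⟩
  · rintro _ ⟨s, hs, t, ht, rfl⟩
    rw [hg]
    exact ⟨union_subset_union (hS.mapsTo hs).1 (hT.mapsTo ht).1,
      (hS.mapsTo hs).2.union (hT.mapsTo ht).2⟩
  · rintro _ ⟨s, hs, t, ht, rfl⟩ _ ⟨s', hs', t', ht', rfl⟩ h
    obtain ⟨hX, hP⟩ := hinter hs ht
    obtain ⟨hX', hP'⟩ := hinter hs' ht'
    rw [hS.injOn hs hs' (by rw [← hX, ← hX', h]), hT.injOn ht ht' (by rw [← hP, ← hP', h])]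
  · intro I hI
    obtain ⟨s, hs, hsI⟩ := hS.surjOn ⟨inter_subset_right, hI.2.inter_of_left X⟩
    obtain ⟨t, ht, htI⟩ := hT.surjOn ⟨inter_subset_right, hI.2.inter_of_left P⟩
    refine ⟨s ⊔ t, sup_mem_sups hs ht, ?_⟩
    rw [hg, hsI, htI, ← inter_union_distrib_left, inter_eq_left.2 hI.1]

end Sups

theorem IsExchangeRel.sups {R G : Set (Set α × Set α)} (hR : IsExchangeRel M X Y R)
    (hG : IsExchangeRel (M ／ X) P Q G) (hXP : Disjoint X P) (hYQ : Disjoint Y Q) :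
    IsExchangeRel M (X ∪ P) (Y ∪ Q) (R ⊻ G) := by
  have hfst := bijOn_sups_finiteSubsets (fun _ _ ↦ rfl) hR.bijOn_fst hG.bijOn_fst hXP
  have hsnd := bijOn_sups_finiteSubsets (fun _ _ ↦ rfl) hR.bijOn_snd hG.bijOn_snd hYQ
  refine ⟨⟨hfst.mapsTo, hsnd.mapsTo, hfst.injOn, hsnd.injOn, ?_⟩, hfst.surjOn, hsnd.surjOn⟩
  rintro _ ⟨r, hr, s, hs, rfl⟩
  have hbasis := isBasis_closure_union_of_contract (hR.isBasis r hr) (hG.isBasis s hs)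
  have hXs : Disjoint X s.1 := hXP.mono_right (hG.mapsTo_fst hs).1
  have hPr : Disjoint P r.1 := (hXP.mono_left (hR.mapsTo_fst hr).1).symm
  have hsdiff : (X ∪ P) \ (r.1 ∪ s.1) = X \ r.1 ∪ P \ s.1 := by
    rw [union_sdiff_distrib, ← sdiff_sdiff, ← sdiff_sdiff, hPr.sdiff_eq_left,
      (hXs.mono_left sdiff_subset).sdiff_eq_left]
  rwa [union_union_union_comm, ← hsdiff] at hbasis

theorem exists_countable_mem_forall_subset {c : α → Set α} (hc : ∀ x, (c x).Countable) (e : α) :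
    ∃ S : Set α, S.Countable ∧ e ∈ S ∧ ∀ x ∈ S, c x ⊆ S := by
  let S (n : ℕ) : Set α := (fun T ↦ ⋃ x ∈ T, c x)^[n] {e}
  have hS (n : ℕ) : S (n + 1) = ⋃ x ∈ S n, c x := Function.iterate_succ_apply' _ n _
  refine ⟨⋃ n, S n, countable_iUnion fun n ↦ ?_, mem_iUnion.2 ⟨0, mem_singleton e⟩, ?_⟩
  · induction n with
    | zero => exact countable_singleton e
    | succ n ih => exact hS n ▸ ih.biUnion fun x _ ↦ hc x
  · intro x hx
    obtain ⟨n, hn⟩ := mem_iUnion.1 hx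
    calc c x ⊆ S (n + 1) := hS n ▸ subset_biUnion_of_mem hn
      _ ⊆ ⋃ n, S n := subset_iUnion S (n + 1)

variable {B₀ B₁ : Set α}

theorem exists_countable_closure_eq [M.Finitary] (hB₀ : M.IsBase B₀) (hB₁ : M.IsBase B₁)
    (he : e ∈ B₀) :
    ∃ P ⊆ B₀, ∃ Q ⊆ B₁, P.Countable ∧ Q.Countable ∧ e ∈ P ∧ M.closure P = M.closure Q := by
  have hsupp {B : Set α} (hB : M.IsBase B) (x : α) :
      ∃ I ⊆ B, I.Countable ∧ (x ∈ M.E → x ∈ M.closure I) := by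
    by_cases hx : x ∈ M.E
    · obtain ⟨I, hIB, hfin, -, hxI⟩ :=
        exists_mem_finite_closure_of_mem_closure (hB.closure_eq.symm ▸ hx)
      exact ⟨I, hIB, hfin.countable, fun _ ↦ hxI⟩
    · exact ⟨∅, empty_subset B, countable_empty, fun h ↦ absurd h hx⟩
  choose I₀ hI₀ hc₀ hcl₀ using hsupp hB₀
  choose I₁ hI₁ hc₁ hcl₁ using hsupp hB₁
  obtain ⟨S, hS, heS, hclosed⟩ :=
    exists_countable_mem_forall_subset (fun x ↦ (hc₀ x).union (hc₁ x)) e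
  refine ⟨S ∩ B₀, inter_subset_right, S ∩ B₁, inter_subset_right, hS.mono inter_subset_left,
    hS.mono inter_subset_left, ⟨heS, he⟩, Subset.antisymm ?_ ?_⟩ <;>
    refine M.closure_subset_closure_of_subset_closure fun x ⟨hxS, hxB⟩ ↦ ?_
  · have hI₁S : I₁ x ⊆ S := subset_union_right.trans (hclosed x hxS)
    exact M.closure_subset_closure (subset_inter hI₁S (hI₁ x)) (hcl₁ x (hB₀.subset_ground hxB))
  · have hI₀S : I₀ x ⊆ S := subset_union_left.trans (hclosed x hxS)
    exact M.closure_subset_closure (subset_inter hI₀S (hI₀ x)) (hcl₀ x (hB₁.subset_ground hxB))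

/-- The triples `(X, Y, R)`, ordered by componentwise inclusion, to which Zorn's lemma is applied:
`R` is an exchange relation between subsets `X ⊆ B₀` and `Y ⊆ B₁` with the same closure. -/
structure IsExchangeStage (M : Matroid α) (B₀ B₁ : Set α)
    (T : Set α × Set α × Set (Set α × Set α)) : Prop where
  left_subset : T.1 ⊆ B₀
  right_subset : T.2.1 ⊆ B₁
  closure_eq : M.closure T.1 = M.closure T.2.1
  isExchangeRel : IsExchangeRel M T.1 T.2.1 T.2.2

namespace IsExchangeStage

variable {T : Set α × Set α × Set (Set α × Set α)}

theorem iUnion_of_isChain {c : Set (Set α × Set α × Set (Set α × Set α))} (hB₀ : M.Indep B₀)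
    (hne : c.Nonempty) (hchain : IsChain (· ≤ ·) c) (hc : ∀ T ∈ c, IsExchangeStage M B₀ B₁ T) :
    IsExchangeStage M B₀ B₁ (⋃ T : c, T.1.1, ⋃ T : c, T.1.2.1, ⋃ T : c, T.1.2.2) := by
  have := hne.to_subtype
  have hdir {β : Type u} [Preorder β] {g : Set α × Set α × Set (Set α × Set α) → β}
      (hg : Monotone g) : Directed (· ≤ ·) fun T : c ↦ g T :=
    hchain.directed.mono_comp (· ≤ ·) hg
  have hsub : ⋃ T : c, T.1.1 ⊆ B₀ := iUnion_subset fun T ↦ (hc T T.2).left_subset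
  exact {
    left_subset := hsub
    right_subset := iUnion_subset fun T ↦ (hc T T.2).right_subset
    closure_eq := M.closure_iUnion_congr _ _ fun T ↦ (hc T T.2).closure_eq
    isExchangeRel := .iUnion_of_directed (fun T ↦ (hc T T.2).isExchangeRel)
      (hdir monotone_fst) (hdir (monotone_fst.comp monotone_snd))
      (hdir (monotone_snd.comp monotone_snd)) (hB₀.subset hsub) }

theorem exists_ge_mem [M.Finitary] (h : IsExchangeStage M B₀ B₁ T) (hB₀ : M.IsBase B₀)
    (hB₁ : M.IsBase B₁) (he : e ∈ B₀) : ∃ T', IsExchangeStage M B₀ B₁ T' ∧ T ≤ T' ∧ e ∈ T'.1 := by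
  by_cases heT : e ∈ T.1
  · exact ⟨T, h, le_rfl, heT⟩
  obtain ⟨X, Y, R⟩ := T
  have hB₀X := isBase_contract_sdiff_of_closure_eq hB₀ h.left_subset rfl
  have hB₁Y := isBase_contract_sdiff_of_closure_eq hB₁ h.right_subset h.closure_eq
  obtain ⟨P, hP, Q, hQ, hPc, hQc, heP, hPQ⟩ := exists_countable_closure_eq hB₀X hB₁Y ⟨he, heT⟩
  obtain ⟨G, hG, hempty⟩ := exists_isExchangeRel_of_countable_of_closure_eq
    (hB₀X.indep.subset hP) (hB₁Y.indep.subset hQ) hPQ hPc hQc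
  refine ⟨(X ∪ P, Y ∪ Q, R ⊻ G), ?_, ⟨subset_union_left, subset_union_left, fun r hr ↦ ?_⟩,
    .inr heP⟩
  · exact {
      left_subset := union_subset h.left_subset (hP.trans sdiff_subset)
      right_subset := union_subset h.right_subset (hQ.trans sdiff_subset)
      closure_eq := (closure_union_eq_of_contract_closure_eq hPQ).trans
        (M.closure_union_congr_left h.closure_eq)
      isExchangeRel := h.isExchangeRel.sups hG
        (disjoint_sdiff_right.mono_right hP) (disjoint_sdiff_right.mono_right hQ) }
  · exact mem_sups.2 ⟨r, hr, (∅, ∅), hempty, sup_bot_eq r⟩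

end IsExchangeStage

theorem exists_isExchangeRel [M.Finitary] (hB₀ : M.IsBase B₀) (hB₁ : M.IsBase B₁) :
    ∃ R, IsExchangeRel M B₀ B₁ R := by
  obtain ⟨R₀, hR₀, -⟩ := exists_isExchangeRel_of_countable_of_closure_eq M.empty_indep
    M.empty_indep rfl countable_empty countable_empty
  obtain ⟨⟨X, Y, R⟩, -, hmax⟩ := zorn_le_nonempty₀ {T | IsExchangeStage M B₀ B₁ T}
    (fun c hc hchain T hT ↦ ⟨_, .iUnion_of_isChain hB₀.indep ⟨T, hT⟩ hchain hc, fun T hT ↦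
      ⟨subset_iUnion_of_subset ⟨T, hT⟩ subset_rfl, subset_iUnion_of_subset ⟨T, hT⟩ subset_rfl,
        subset_iUnion_of_subset ⟨T, hT⟩ subset_rfl⟩⟩)
    (∅, ∅, R₀) ⟨empty_subset B₀, empty_subset B₁, rfl, hR₀⟩
  have hstage : IsExchangeStage M B₀ B₁ (X, Y, R) := hmax.prop
  have hX : X = B₀ := hstage.left_subset.antisymm fun e he ↦ by
    obtain ⟨T, hT, hle, heT⟩ := hstage.exists_ge_mem hB₀ hB₁ he
    exact (hmax.le_of_ge hT hle).1 heT
  subst hX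
  have hYbase : M.IsBase Y := (hB₁.indep.subset hstage.right_subset).isBase_of_ground_subset_closure
    (hB₀.closure_eq.symm.trans hstage.closure_eq).subset
  rw [← hYbase.eq_of_subset_isBase hB₁ hstage.right_subset]
  exact ⟨R, hstage.isExchangeRel⟩

theorem mainTheorem2 {α : Type*} (M : Matroid α) [M.Finitary] (B₀ B₁ : Set α)
    (hB₀ : M.IsBase B₀) (hB₁ : M.IsBase B₁) :
    ∃ F : {I : Set α // I ⊆ B₀ ∧ I.Finite} → {J : Set α // J ⊆ B₁ ∧ J.Finite},
      Function.Bijective F ∧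
        ∀ I : {I : Set α // I ⊆ B₀ ∧ I.Finite},
          M.IsBase ((B₀ \ (I : Set α)) ∪ (F I : Set α)) := by
  obtain ⟨R, hR⟩ := exists_isExchangeRel hB₀ hB₁
  let left : R ≃ finiteSubsets B₀ := hR.bijOn_fst.equiv Prod.fst
  let right : R ≃ finiteSubsets B₁ := hR.bijOn_snd.equiv Prod.snd
  refine ⟨left.symm.trans right, (left.symm.trans right).bijective, fun I ↦ ?_⟩
  obtain ⟨p, rfl⟩ := left.surjective I
  rw [Equiv.trans_apply, left.symm_apply_apply]
  exact hR.isBase hB₀ p.2
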